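/- Index sequences by $\mathbb N=\{1,2,\dots\}$. For $\varepsilon,\sigma>0$, $\theta\in\ell^2(\mathbb N)$ and a positive sequence $b=(b_j)$, let $\mathbb P_{\theta,b}$ be the joint law of the observations $Y_j=b_j\theta_j+\varepsilon\xi_j$, $X_j=b_j+\sigma\eta_j$, $j\in\mathbb N$, where all the $\xi_j,\eta_j$ are independent standard Gaussian variables. Let $a=(a_j)$ be a non-decreasing sequence of positive reals tending to infinity, $\mathcal E_a=\{\theta\in\ell^2(\mathbb N):\sum_j a_j^2\theta_j^2\le 1\}$, and $\Theta_a(r)=\{\theta\in\mathcal E_a:\|\theta\|\ge r\}$. Let $\mathcal B$ be a set of positive sequences, the possible values of the unknown $b$ (it may be a single sequence). A test $\Psi$ assigns to each known benchmark $\theta_0$ a measurable function $\Psi_{\theta_0}$ of $(Y,X)$ with values in $\{0,1\}$. It has level $\alpha$ if $\mathbb P_{\theta_0,b}(\Psi_{\theta_0}=1)\le\alpha$ for all $\theta_0\in\mathcal E_a$ and $b\in\mathcal B$. Its separation radius is the infimum of the $r>0$ such that $\mathbb P_{\theta,b}(\Psi_{\theta_0}=0)\le\beta$ for all $b\in\mathcal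 B$, $\theta_0\in\mathcal E_a$ and $\theta$ with $\theta-\theta_0\in\Theta_a(r)$. The minimax separation radius $\tilde r_{\varepsilon,\sigma}$ is the infimum of the separation radii of all tests of level $\alpha$. For sequences, $c_j\sim d_j$ means that $\kappa_0\le c_j/d_j\le\kappa_1$ for all $j\in\mathbb N$, with constants $0<\kappa_0\le\kappa_1<\infty$; "$b_j\sim d_j$ on $\mathcal B$" means that this holds for all $b\in\mathcal B$ with common constants. Theorem. Let $\alpha,\beta\in(0,1)$ and $s,t>0$. In each of the following four cases there are $\varepsilon_0,\sigma_0\in(0,1)$ and $C>0$ such that, for all $0<\varepsilon\le\varepsilon_0$ and $0<\sigma\le\sigma_0$, the stated bound holds. (i) If $b_j\sim j^{-t}$ on $\mathcal B$ and $a_j\sim j^{s}$, then $$\tilde r_{\varepsilon,\sigma}^2\le C\Big(\varepsilon^{\frac{4s}{2s+2t+1/2}}\vee\big[\sigma\ln^{3/4}(1/\sigma)\big]^{2(\frac st\wedge1)}\Big).$$ (ii) If $b_j\sim j^{-t}$ on $\mathcal B$ and $a_j\sim e^{js}$, then $$\tilde r_{\varepsilon,\sigma}^2\le C\Big(\varepsilon^2[\ln(1/\varepsilon)]^{2t+1/2}\vee\sigma^2\ln^{3/2}(1/\sigma)\Big).$$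 (iii) If $b_j\sim e^{-jt}$ on $\mathcal B$ and $a_j\sim j^{s}$, then $$\tilde r_{\varepsilon,\sigma}^2\le C\bigg([\ln(1/\varepsilon)]^{-2s}\vee\Big[\ln\Big(\frac1{\sigma\ln^{1/2}(1/\sigma)}\Big)\Big]^{-2s}\bigg).$$ (iv) If $b_j\sim e^{-jt}$ on $\mathcal B$ and $a_j\sim e^{js}$, then $$\tilde r_{\varepsilon,\sigma}^2\le C\Big(\varepsilon^{\frac{2s}{s+t}}\vee\big[\sigma\ln^{1/2}(1/\sigma)\big]^{2(\frac st\wedge1)}\Big).$$ -/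

import Mathlib

open MeasureTheory ProbabilityTheory Set Filter Topology
open scoped ENNReal NNReal

noncomputable section

namespace GSM

/-- Square-summable real sequences indexed by `{1, 2, …}`, with their Hilbert norm. -/
abbrev L2 : Type := lp (fun _ : ℕ+ => ℝ) 2

/-- The space of observations `(Y, X) = ((Y_j)_j, (X_j)_j)`. -/
abbrev Obs : Type := (ℕ+ → ℝ) × (ℕ+ → ℝ)

/-- The law of the noise `(ξ, η)`: all the coordinates are independent standard Gaussians. -/
def noise : Measure Obs :=
  (Measure.infinitePi fun _ : ℕ+ => gaussianReal 0 1).prod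
    (Measure.infinitePi fun _ : ℕ+ => gaussianReal 0 1)

/-- The observations produced by the noise `(ξ, η)`:
`Y_j = b_j θ_j + ε ξ_j` and `X_j = b_j + σ η_j`. -/
def observe (ε σ : ℝ) (θ : L2) (b : ℕ+ → ℝ) (ω : Obs) : Obs :=
  (fun j => b j * θ j + ε * ω.1 j, fun j => b j + σ * ω.2 j)

/-- The joint law `P_{θ,b}` of the observations at the noise levels `ε, σ`. -/
def law (ε σ : ℝ) (θ : L2) (b : ℕ+ → ℝ) : Measure Obs :=
  noise.map (observe ε σ θ b)

/-- A smoothness sequence: positive, non-decreasing, and tending to infinity. -/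
structure IsSmoothness (a : ℕ+ → ℝ) : Prop where
  pos : ∀ j, 0 < a j
  mono : Monotone a
  tendsto : Tendsto a atTop atTop

/-- The ellipsoid `{θ ∈ ℓ² : ∑ a_j² θ_j² ≤ 1}`. -/
def ellipsoid (a : ℕ+ → ℝ) : Set L2 :=
  {θ | Summable (fun j => a j ^ 2 * θ j ^ 2) ∧ ∑' j, a j ^ 2 * θ j ^ 2 ≤ 1}

/-- The ellipsoid with the ball of radius `r` removed. -/
def separated (a : ℕ+ → ℝ) (r : ℝ) : Set L2 :=
  {θ | θ ∈ ellipsoid a ∧ r ≤ ‖θ‖}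

/-- A non-randomized test of `θ = θ₀`. The benchmark `θ₀` is known, so the test may use it; the
singular values `b` are unknown, so the test sees them only through the observations.
The value `1` means that the null hypothesis is rejected. -/
structure Test where
  toFun : L2 → Obs → Fin 2
  measurable : ∀ θ₀, Measurable (toFun θ₀)

/-- `Ψ` has level `α` when the unknown `b` ranges over `B`: for every benchmark in the ellipsoid,
the first kind error probability is at most `α`. -/
def HasLevel (a : ℕ+ → ℝ) (B : Set (ℕ+ → ℝ)) (ε σ α : ℝ) (Ψ : Test) : Prop :=
  ∀ θ₀ ∈ ellipsoid a, ∀ b ∈ B, law ε σ θ₀ b {x | Ψ.toFun θ₀ x = 1} ≤ ENNReal.ofReal α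

/-- The maximal second kind error probability of `Ψ` at the radius `r`. -/
def secondKindError (a : ℕ+ → ℝ) (B : Set (ℕ+ → ℝ)) (ε σ r : ℝ) (Ψ : Test) : ℝ≥0∞ :=
  ⨆ (θ₀ : L2) (θ : L2) (b : ℕ+ → ℝ) (_ : θ₀ ∈ ellipsoid a) (_ : θ - θ₀ ∈ separated a r)
    (_ : b ∈ B), law ε σ θ b {x | Ψ.toFun θ₀ x = 0}

/-- The separation radius of `Ψ`: the infimum of the `r > 0` at which the maximal second kind
error probability is at most `β`. -/
def separationRadius (a : ℕ+ → ℝ) (B : Set (ℕ+ → ℝ)) (ε σ β : ℝ) (Ψ : Test) : ℝ≥0∞ :=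
  ⨅ (r : ℝ) (_ : 0 < r) (_ : secondKindError a B ε σ r Ψ ≤ ENNReal.ofReal β), ENNReal.ofReal r

/-- The minimax separation radius: the infimum of the separation radii of the level-`α` tests. -/
def minimaxRadius (a : ℕ+ → ℝ) (B : Set (ℕ+ → ℝ)) (α β ε σ : ℝ) : ℝ≥0∞ :=
  ⨅ (Ψ : Test) (_ : HasLevel a B ε σ α Ψ), separationRadius a B ε σ β Ψ

/-- `c_j ∼ d_j` for all the sequences `c ∈ S`, with common constants. -/
def EquivOn (S : Set (ℕ+ → ℝ)) (d : ℕ+ → ℝ) : Prop :=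
  ∃ κ₀ κ₁ : ℝ, 0 < κ₀ ∧ κ₀ ≤ κ₁ ∧ ∀ c ∈ S, ∀ j, κ₀ ≤ c j / d j ∧ c j / d j ≤ κ₁

/-- `c_j ∼ d_j`: the ratio stays between two positive constants. -/
def SeqEquiv (c d : ℕ+ → ℝ) : Prop :=
  ∃ κ₀ κ₁ : ℝ, 0 < κ₀ ∧ κ₀ ≤ κ₁ ∧ ∀ j, κ₀ ≤ c j / d j ∧ c j / d j ≤ κ₁

/-- For all small enough noise levels, the squared minimax separation radius is at most a constant
times `rate ε σ`. -/
def HasUpperRate (a : ℕ+ → ℝ) (B : Set (ℕ+ → ℝ)) (α β : ℝ) (rate : ℝ → ℝ → ℝ) : Prop :=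
  ∃ ε₀ ∈ Ioo (0 : ℝ) 1, ∃ σ₀ ∈ Ioo (0 : ℝ) 1, ∃ C : ℝ, 0 < C ∧
    ∀ ε σ : ℝ, 0 < ε → ε ≤ ε₀ → 0 < σ → σ ≤ σ₀ →
      minimaxRadius a B α β ε σ ^ 2 ≤ ENNReal.ofReal (C * rate ε σ)

end GSM

end

/-!
Under `θ = θ₀` the residuals `Y_j - θ₀_j X_j` are centred, and whatever `θ` and `b` are they have
the variance `ε² + σ² θ₀_j²`, which is known because `θ₀` is. When `d_j` is a lower bound for the
unknown `b_j`, the sum over `j ≤ D` of `d_j⁻²` times the squared residuals, recentred by these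
variances, has a mean of at least `∑_{j ≤ D} (θ - θ₀)_j²`, and Chebyshev's inequality controls both
errors of the test based on it. As `a_j² θ₀_j² ≤ 1` on the ellipsoid, the fluctuations are of order
`ε² (∑_{j ≤ D} d_j⁻⁴)^{1/2} + σ² max_{j ≤ D} (a_j d_j)⁻²`, while the coordinates beyond `D` hide
at most `a_D⁻²`. Each of the four rates comes from the choice of `D` that balances these terms.
-/

noncomputable section

namespace GSM

section GaussianMoments

variable (m : ℝ) (v : ℝ≥0)

lemma deriv_mul_exp_quadratic {p p' : ℝ → ℝ} (hp : ∀ t, HasDerivAt p (p' t) t) :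
    deriv (fun t => p t * Real.exp (m * t + v * t ^ 2 / 2)) =
      fun t => (p' t + p t * (m + v * t)) * Real.exp (m * t + v * t ^ 2 / 2) := by
  ext t
  have hquad : HasDerivAt (fun t : ℝ => m * t + v * t ^ 2 / 2) (m + v * t) t :=
    (((hasDerivAt_id t).const_mul m).add
      (((hasDerivAt_pow 2 t).const_mul (v : ℝ)).div_const 2)).congr_deriv (by norm_num; ring)
  exact (((hp t).mul hquad.exp).congr_deriv (by ring)).deriv

lemma integral_pow_gaussianReal (n : ℕ) :
    ∫ x, x ^ n ∂gaussianReal m v =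
      iteratedDeriv n (fun t => Real.exp (m * t + v * t ^ 2 / 2)) 0 := by
  rw [← mgf_id_gaussianReal, iteratedDeriv_mgf_zero (by simp)]
  rfl

lemma iteratedDeriv_two_exp_quadratic :
    iteratedDeriv 2 (fun t : ℝ => Real.exp (m * t + v * t ^ 2 / 2)) =
      fun t => (v + (m + v * t) ^ 2) * Real.exp (m * t + v * t ^ 2 / 2) := by
  have hlin (t : ℝ) : HasDerivAt (fun t : ℝ => m + v * t) v t := by
    simpa using ((hasDerivAt_id t).const_mul (v : ℝ)).const_add m
  have h₁ := deriv_mul_exp_quadratic m v fun t => hasDerivAt_const t (1 : ℝ)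
  simp only [one_mul, zero_add] at h₁
  rw [iteratedDeriv_succ, iteratedDeriv_one, h₁, deriv_mul_exp_quadratic m v hlin]
  simp only [sq]

lemma iteratedDeriv_four_exp_quadratic :
    iteratedDeriv 4 (fun t : ℝ => Real.exp (m * t + v * t ^ 2 / 2)) =
      fun t => (3 * v ^ 2 + 6 * v * (m + v * t) ^ 2 + (m + v * t) ^ 4) *
        Real.exp (m * t + v * t ^ 2 / 2) := by
  have hlin (t : ℝ) : HasDerivAt (fun t : ℝ => m + v * t) v t := by
    simpa using ((hasDerivAt_id t).const_mul (v : ℝ)).const_add m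
  have h₂ (t : ℝ) : HasDerivAt (fun t : ℝ => v + (m + v * t) ^ 2) (2 * v * (m + v * t)) t :=
    (((hlin t).pow 2).const_add (v : ℝ)).congr_deriv (by norm_num; ring)
  have h₃ (t : ℝ) : HasDerivAt (fun t : ℝ => 2 * v * (m + v * t) +
      (v + (m + v * t) ^ 2) * (m + v * t)) (3 * v ^ 2 + 3 * v * (m + v * t) ^ 2) t :=
    (((hlin t).const_mul (2 * v : ℝ)).add ((h₂ t).mul (hlin t))).congr_deriv (by ring)
  rw [iteratedDeriv_succ, iteratedDeriv_succ, iteratedDeriv_two_exp_quadratic,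
    deriv_mul_exp_quadratic m v h₂, deriv_mul_exp_quadratic m v h₃]
  ext t
  ring

lemma integral_sq_gaussianReal : ∫ x, x ^ 2 ∂gaussianReal m v = m ^ 2 + v := by
  rw [integral_pow_gaussianReal, iteratedDeriv_two_exp_quadratic]
  simp [add_comm]

lemma integral_pow_four_gaussianReal :
    ∫ x, x ^ 4 ∂gaussianReal m v = m ^ 4 + 6 * m ^ 2 * v + 3 * v ^ 2 := by
  rw [integral_pow_gaussianReal, iteratedDeriv_four_exp_quadratic]
  norm_num
  ring

lemma memLp_sq_gaussianReal : MemLp (fun x : ℝ => x ^ 2) 2 (gaussianReal m v) := by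
  have h := (memLp_id_gaussianReal' (μ := m) (v := v) 4 (by simp)).norm_rpow_div 2
  have h42 : (4 : ℝ≥0∞) / 2 = 2 := by
    rw [eq_comm, ENNReal.eq_div_iff (by simp) (by simp)]
    norm_num
  simpa [h42] using h

lemma variance_sq_gaussianReal :
    Var[fun x => x ^ 2; gaussianReal m v] = 4 * m ^ 2 * v + 2 * v ^ 2 := by
  have hpow : (fun x : ℝ => x ^ 2) ^ 2 = fun x => x ^ 4 := by ext x; simp [← pow_mul]
  rw [variance_eq_sub (memLp_sq_gaussianReal m v), hpow, integral_pow_four_gaussianReal,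
    integral_sq_gaussianReal]
  ring

end GaussianMoments

section ProductIndependence

variable {Ω Ω' ι κ E : Type*} [MeasurableSpace Ω] [MeasurableSpace Ω'] [MeasurableSpace E]
  {P : Measure Ω} {P' : Measure Ω'}

lemma iIndepFun_sumElim_prod {f : ι → Ω → E} {g : κ → Ω' → E}
    (hf : iIndepFun f P) (hg : iIndepFun g P') :
    iIndepFun (Sum.elim (fun i ω => f i ω.1) (fun k ω => g k ω.2)) (P.prod P') := by
  classical
  have := hf.isProbabilityMeasure
  have := hg.isProbabilityMeasure
  rw [iIndepFun_iff_measure_inter_preimage_eq_mul]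
  intro S A hA
  have hrect : (⋂ i ∈ S, Sum.elim (fun i ω => f i ω.1) (fun k ω => g k ω.2) i ⁻¹' A i) =
      (⋂ i ∈ S.toLeft, f i ⁻¹' A (Sum.inl i)) ×ˢ (⋂ k ∈ S.toRight, g k ⁻¹' A (Sum.inr k)) := by
    ext ω
    simp
  have hleft (i : ι) : P.prod P' ((fun ω => f i ω.1) ⁻¹' A (Sum.inl i)) =
      P (f i ⁻¹' A (Sum.inl i)) := by
    rw [← mul_one (P _), ← measure_univ (μ := P'), ← Measure.prod_prod]
    congr 1; ext; simp
  have hright (k : κ) : P.prod P' ((fun ω => g k ω.2) ⁻¹' A (Sum.inr k)) =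
      P' (g k ⁻¹' A (Sum.inr k)) := by
    rw [← one_mul (P' _), ← measure_univ (μ := P), ← Measure.prod_prod]
    congr 1; ext; simp
  rw [hrect, Measure.prod_prod,
    hf.measure_inter_preimage_eq_mul S.toLeft fun _ hi => hA _ (Finset.mem_toLeft.1 hi),
    hg.measure_inter_preimage_eq_mul S.toRight fun _ hk => hA _ (Finset.mem_toRight.1 hk)]
  conv_rhs => rw [← Finset.toLeft_disjSum_toRight (u := S)]
  simp only [Finset.prod_disjSum, Sum.elim_inl, Sum.elim_inr, hleft, hright]

end ProductIndependence

section QuadraticStatistic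

variable {Ω ι : Type*} [MeasurableSpace Ω] {P : Measure Ω} {Z : ι → Ω → ℝ} {m w : ι → ℝ}
  {v : ι → ℝ≥0} {S : Finset ι} {q H : ℝ}

/-- The quadratic statistic `∑ w_j (Z_j² - v_j)`, an unbiased estimator of `∑ w_j m_j²` when each
`Z_j` has mean `m_j` and variance `v_j`. -/
def quadStat (w : ι → ℝ) (v : ι → ℝ≥0) (Z : ι → Ω → ℝ) (S : Finset ι) (ω : Ω) : ℝ :=
  ∑ j ∈ S, w j * (Z j ω ^ 2 - v j)

lemma memLp_sq_of_hasLaw_gaussianReal {X : Ω → ℝ} {μ : ℝ} {τ : ℝ≥0}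
    (hX : HasLaw X (gaussianReal μ τ) P) : MemLp (fun ω => X ω ^ 2) 2 P := by
  have h := memLp_sq_gaussianReal μ τ
  rw [← hX.map_eq] at h
  exact h.comp_of_map hX.aemeasurable

lemma variance_sq_of_hasLaw_gaussianReal {X : Ω → ℝ} {μ : ℝ} {τ : ℝ≥0}
    (hX : HasLaw X (gaussianReal μ τ) P) :
    Var[fun ω => X ω ^ 2; P] = 4 * μ ^ 2 * τ + 2 * τ ^ 2 := by
  rw [← variance_sq_gaussianReal, ← hX.map_eq, variance_map (by fun_prop) hX.aemeasurable]
  rfl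

lemma memLp_quadStat_term {X : Ω → ℝ} {μ : ℝ} {τ : ℝ≥0} (hX : HasLaw X (gaussianReal μ τ) P)
    (c : ℝ) : MemLp (fun ω => c * (X ω ^ 2 - τ)) 2 P := by
  have := hX.isProbabilityMeasure
  exact ((memLp_sq_of_hasLaw_gaussianReal hX).sub (memLp_const _)).const_mul c

variable (hZ : ∀ j, HasLaw (Z j) (gaussianReal (m j) (v j)) P)
include hZ

lemma memLp_quadStat : MemLp (quadStat w v Z S) 2 P :=
  memLp_finsetSum S fun j _ => memLp_quadStat_term (hZ j) (w j)

lemma integral_quadStat : ∫ ω, quadStat w v Z S ω ∂P = ∑ j ∈ S, w j * m j ^ 2 := by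
  have hint (j : ι) : Integrable (fun ω => w j * (Z j ω ^ 2 - v j)) P := by
    have := (hZ j).isProbabilityMeasure
    exact (memLp_quadStat_term (hZ j) (w j)).integrable one_le_two
  simp only [quadStat]
  rw [integral_finsetSum S fun j _ => hint j]
  refine Finset.sum_congr rfl fun j _ => ?_
  have := (hZ j).isProbabilityMeasure
  have hsq : ∫ ω, Z j ω ^ 2 ∂P = m j ^ 2 + v j := by
    rw [← integral_sq_gaussianReal]
    exact (hZ j).integral_comp (f := fun x => x ^ 2) (by fun_prop)
  rw [integral_const_mul, integral_sub
    ((memLp_sq_of_hasLaw_gaussianReal (hZ j)).integrable one_le_two) (integrable_const _), hsq]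
  simp

variable (hind : Pairwise fun i j => IndepFun (Z i) (Z j) P)
include hind

lemma variance_quadStat :
    Var[quadStat w v Z S; P] = ∑ j ∈ S, w j ^ 2 * (4 * m j ^ 2 * v j + 2 * v j ^ 2) := by
  have hsum : quadStat w v Z S = ∑ j ∈ S, fun ω => w j * (Z j ω ^ 2 - v j) := by
    ext ω; simp [quadStat]
  rw [hsum, IndepFun.variance_sum fun j _ => memLp_quadStat_term (hZ j) (w j)]
  · refine Finset.sum_congr rfl fun j _ => ?_
    have := (hZ j).isProbabilityMeasure
    have hmeas := (memLp_sq_of_hasLaw_gaussianReal (hZ j)).aestronglyMeasurable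
    rw [variance_const_mul, variance_sub_const hmeas, variance_sq_of_hasLaw_gaussianReal (hZ j)]
  · exact fun i _ j _ hij => (hind hij).comp (φ := fun z => w i * (z ^ 2 - v i))
      (ψ := fun z => w j * (z ^ 2 - v j)) (by fun_prop) (by fun_prop)

variable (hw : ∀ j, 0 ≤ w j) (hv : ∑ j ∈ S, (w j * v j) ^ 2 ≤ q ^ 2)
include hw hv

lemma variance_quadStat_le (hq : 0 ≤ q) :
    Var[quadStat w v Z S; P] ≤ 4 * q * ∑ j ∈ S, w j * m j ^ 2 + 2 * q ^ 2 := by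
  have hle_q : ∀ j ∈ S, w j * v j ≤ q := fun j hj => by
    have hterm := Finset.single_le_sum (f := fun j => (w j * v j) ^ 2) (fun _ _ => sq_nonneg _) hj
    exact le_of_sq_le_sq (hterm.trans hv) hq
  rw [variance_quadStat hZ hind]
  calc ∑ j ∈ S, w j ^ 2 * (4 * m j ^ 2 * v j + 2 * v j ^ 2)
      = ∑ j ∈ S, (4 * (w j * v j) * (w j * m j ^ 2) + 2 * (w j * v j) ^ 2) :=
        Finset.sum_congr rfl fun j _ => by ring
    _ ≤ ∑ j ∈ S, (4 * q * (w j * m j ^ 2) + 2 * (w j * v j) ^ 2) := by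
        gcongr with j hj
        · exact mul_nonneg (hw j) (sq_nonneg _)
        · exact hle_q j hj
    _ = 4 * q * ∑ j ∈ S, w j * m j ^ 2 + 2 * ∑ j ∈ S, (w j * v j) ^ 2 := by
        rw [Finset.sum_add_distrib, Finset.mul_sum, Finset.mul_sum]
    _ ≤ 4 * q * ∑ j ∈ S, w j * m j ^ 2 + 2 * q ^ 2 := by gcongr

lemma measure_lt_quadStat_le [IsProbabilityMeasure P] (hm : ∀ j, m j = 0) (hq : 0 < q)
    (hH : 0 < H) :
    P {ω | H * q < quadStat w v Z S ω} ≤ ENNReal.ofReal (2 / H ^ 2) := by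
  have hmean : ∑ j ∈ S, w j * m j ^ 2 = 0 := by simp [hm]
  have hvar := variance_quadStat_le hZ hind hw hv hq.le
  rw [hmean, mul_zero, zero_add] at hvar
  have hcheb := meas_ge_le_variance_div_sq (memLp_quadStat hZ (S := S) (w := w)) (mul_pos hH hq)
  rw [integral_quadStat hZ, hmean] at hcheb
  refine (measure_mono fun ω hω => ?_).trans (hcheb.trans (ENNReal.ofReal_le_ofReal ?_))
  · simpa using (le_of_lt hω).trans (le_abs_self _)
  · calc Var[quadStat w v Z S; P] / (H * q) ^ 2 ≤ 2 * q ^ 2 / (H * q) ^ 2 := by gcongr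
      _ = 2 / H ^ 2 := by field_simp

lemma measure_quadStat_le_le [IsProbabilityMeasure P] (hq : 0 < q) (hH : 1 ≤ H)
    (hsep : 2 * H * q ≤ ∑ j ∈ S, w j * m j ^ 2) :
    P {ω | quadStat w v Z S ω ≤ H * q} ≤ ENNReal.ofReal (10 / H) := by
  have hvar := variance_quadStat_le hZ hind hw hv hq.le
  set M := ∑ j ∈ S, w j * m j ^ 2
  have hM : 0 < M := lt_of_lt_of_le (by positivity) hsep
  have hcheb := meas_ge_le_variance_div_sq (memLp_quadStat hZ (S := S) (w := w)) (half_pos hM)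
  rw [integral_quadStat hZ] at hcheb
  refine (measure_mono fun ω hω => ?_).trans (hcheb.trans (ENNReal.ofReal_le_ofReal ?_))
  · have hω : quadStat w v Z S ω ≤ H * q := hω
    change M / 2 ≤ |quadStat w v Z S ω - M|
    rw [abs_sub_comm]
    exact le_trans (by linarith) (le_abs_self _)
  · rw [div_le_div_iff₀ (by positivity) (by positivity)]
    have hqH : q * H ≤ M / 2 := by linarith
    have hqM : q ≤ M / 2 := by nlinarith
    calc Var[quadStat w v Z S; P] * H ≤ (4 * q * M + 2 * q ^ 2) * H := by gcongr
      _ = (4 * M + 2 * q) * (q * H) := by ring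
      _ ≤ (4 * M + 2 * (M / 2)) * (M / 2) := by gcongr
      _ = 10 * (M / 2) ^ 2 := by ring

end QuadraticStatistic

section Residuals

instance isProbabilityMeasure_noise : IsProbabilityMeasure noise := by
  unfold noise; infer_instance

lemma measurable_observe (ε σ : ℝ) (θ : L2) (b : ℕ+ → ℝ) : Measurable (observe ε σ θ b) := by
  unfold observe; fun_prop

lemma hasLaw_noise_fst (j : ℕ+) : HasLaw (fun ω : Obs => ω.1 j) (gaussianReal 0 1) noise :=
  ((measurePreserving_eval_infinitePi (fun _ : ℕ+ => gaussianReal 0 1) j).comp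
    measurePreserving_fst).hasLaw

lemma hasLaw_noise_snd (j : ℕ+) : HasLaw (fun ω : Obs => ω.2 j) (gaussianReal 0 1) noise :=
  ((measurePreserving_eval_infinitePi (fun _ : ℕ+ => gaussianReal 0 1) j).comp
    measurePreserving_snd).hasLaw

lemma iIndepFun_noise :
    iIndepFun (Sum.elim (fun j (ω : Obs) => ω.1 j) (fun j (ω : Obs) => ω.2 j)) noise :=
  iIndepFun_sumElim_prod (iIndepFun_infinitePi (X := fun _ x => x) fun _ => measurable_id)
    (iIndepFun_infinitePi (X := fun _ x => x) fun _ => measurable_id)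

/-- The residual `Y_j - θ₀_j X_j`: it is centred exactly when `θ_j = θ₀_j`, whatever the unknown
`b_j > 0` is. -/
def residual (θ₀ : L2) (j : ℕ+) (x : Obs) : ℝ := x.1 j - θ₀ j * x.2 j

/-- The variance `ε² + σ² θ₀_j²` of the residual, which depends on neither `θ` nor `b`. -/
def residualVar (ε σ : ℝ) (θ₀ : L2) (j : ℕ+) : ℝ≥0 :=
  ⟨ε ^ 2 + (σ * θ₀ j) ^ 2, by positivity⟩

variable (ε σ : ℝ) (θ₀ θ : L2) (b : ℕ+ → ℝ)

lemma measurable_residual (j : ℕ+) : Measurable (residual θ₀ j) := by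
  unfold residual; fun_prop

lemma residual_observe (j : ℕ+) (ω : Obs) :
    residual θ₀ j (observe ε σ θ b ω) =
      b j * (θ - θ₀) j + (ε * ω.1 j + -(σ * θ₀ j) * ω.2 j) := by
  simp only [residual, observe, lp.coeFn_sub, Pi.sub_apply]
  ring

lemma hasLaw_residual_observe (j : ℕ+) :
    HasLaw (fun ω => residual θ₀ j (observe ε σ θ b ω))
      (gaussianReal (b j * (θ - θ₀) j) (residualVar ε σ θ₀ j)) noise := by
  have hξ := gaussianReal_const_mul (hasLaw_noise_fst j) ε
  have hη := gaussianReal_const_mul (hasLaw_noise_snd j) (-(σ * θ₀ j))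
  have hind : IndepFun (fun ω : Obs => ε * ω.1 j) (fun ω : Obs => -(σ * θ₀ j) * ω.2 j) noise :=
    (iIndepFun_noise.indepFun (i := Sum.inl j) (j := Sum.inr j) (by simp)).comp
      (measurable_const_mul ε) (measurable_const_mul (-(σ * θ₀ j)))
  have hsum : HasLaw (fun ω : Obs => ε * ω.1 j + -(σ * θ₀ j) * ω.2 j)
      (gaussianReal 0 (residualVar ε σ θ₀ j)) noise := by
    refine ⟨hξ.aemeasurable.add hη.aemeasurable,
      (gaussianReal_add_gaussianReal_of_indepFun hind hξ.map_eq hη.map_eq).trans ?_⟩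
    congr 1
    · simp
    · ext
      change ε ^ 2 * 1 + (-(σ * θ₀ j)) ^ 2 * 1 = ε ^ 2 + (σ * θ₀ j) ^ 2
      ring
  simpa [residual_observe] using gaussianReal_const_add hsum (b j * (θ - θ₀) j)

lemma pairwise_indepFun_residual_observe :
    Pairwise fun i j => IndepFun (fun ω => residual θ₀ i (observe ε σ θ b ω))
      (fun ω => residual θ₀ j (observe ε σ θ b ω)) noise := by
  intro i j hij
  have hind := iIndepFun_noise.indepFun_prodMk_prodMk
    (fun i => by cases i <;> simp only [Sum.elim_inl, Sum.elim_inr] <;> fun_prop)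
    (Sum.inl i) (Sum.inr i) (Sum.inl j) (Sum.inr j) (by simpa) (by simp) (by simp) (by simpa)
  simp only [residual_observe]
  exact hind.comp (φ := fun p => b i * (θ - θ₀) i + (ε * p.1 + -(σ * θ₀ i) * p.2))
    (ψ := fun p => b j * (θ - θ₀) j + (ε * p.1 + -(σ * θ₀ j) * p.2)) (by fun_prop) (by fun_prop)

end Residuals

section ResidualTest

/-- The test that rejects `θ = θ₀` when the quadratic statistic of the residuals with the weights
`w`, over the coordinates in `S`, exceeds `h`. -/
def residualTest (ε σ : ℝ) (w : ℕ+ → ℝ) (S : Finset ℕ+) (h : ℝ) : Test where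
  toFun θ₀ x := if h < quadStat w (residualVar ε σ θ₀) (residual θ₀) S x then 1 else 0
  measurable θ₀ := by
    have hmeas := measurable_residual θ₀
    exact Measurable.ite (measurableSet_lt measurable_const (by unfold quadStat; fun_prop))
      measurable_const measurable_const

variable {b w : ℕ+ → ℝ} {ε σ q H : ℝ} {S : Finset ℕ+} {θ₀ θ : L2}

lemma law_residualTest_eq (h : ℝ) (i : Fin 2) :
    law ε σ θ b {x | (residualTest ε σ w S h).toFun θ₀ x = i} =
      noise {ω | (residualTest ε σ w S h).toFun θ₀ (observe ε σ θ b ω) = i} :=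
  Measure.map_apply (measurable_observe ε σ θ b)
    ((residualTest ε σ w S h).measurable θ₀ (measurableSet_singleton i))

lemma law_residualTest_eq_one_le (hw : ∀ j, 0 ≤ w j) (hq : 0 < q)
    (hnoise : ∑ j ∈ S, (w j * residualVar ε σ θ₀ j) ^ 2 ≤ q ^ 2) (hH : 0 < H) :
    law ε σ θ₀ b {x | (residualTest ε σ w S (H * q)).toFun θ₀ x = 1} ≤
      ENNReal.ofReal (2 / H ^ 2) := by
  have hbound := measure_lt_quadStat_le (hasLaw_residual_observe ε σ θ₀ θ₀ b)
    (pairwise_indepFun_residual_observe ε σ θ₀ θ₀ b) hw hnoise (fun j => by simp) hq hH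
  rw [law_residualTest_eq]
  refine (measure_mono fun ω hω => ?_).trans hbound
  have hreject : H * q < quadStat w (residualVar ε σ θ₀) (residual θ₀) S (observe ε σ θ₀ b ω) := by
    simpa [residualTest] using hω
  exact hreject

lemma law_residualTest_eq_zero_le (hw : ∀ j, 0 ≤ w j) (hq : 0 < q)
    (hnoise : ∑ j ∈ S, (w j * residualVar ε σ θ₀ j) ^ 2 ≤ q ^ 2) (hH : 1 ≤ H)
    (hsep : 2 * H * q ≤ ∑ j ∈ S, w j * (b j * (θ - θ₀) j) ^ 2) :
    law ε σ θ b {x | (residualTest ε σ w S (H * q)).toFun θ₀ x = 0} ≤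
      ENNReal.ofReal (10 / H) := by
  have hbound := measure_quadStat_le_le (hasLaw_residual_observe ε σ θ₀ θ b)
    (pairwise_indepFun_residual_observe ε σ θ₀ θ b) hw hnoise hq hH hsep
  rw [law_residualTest_eq]
  refine (measure_mono fun ω hω => ?_).trans hbound
  have haccept : quadStat w (residualVar ε σ θ₀) (residual θ₀) S (observe ε σ θ b ω) ≤ H * q := by
    simpa [residualTest] using hω
  exact haccept

end ResidualTest

section Ellipsoid

variable {a d : ℕ+ → ℝ} {θ : L2} {S : Finset ℕ+}

lemma sum_le_one_of_mem_ellipsoid (hθ : θ ∈ ellipsoid a) (S : Finset ℕ+) :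
    ∑ j ∈ S, a j ^ 2 * θ j ^ 2 ≤ 1 :=
  (hθ.1.sum_le_tsum S fun j _ => by positivity).trans hθ.2

lemma hasSum_sq (θ : L2) : HasSum (fun j => θ j ^ 2) (‖θ‖ ^ 2) := by
  simpa using lp.hasSum_norm (p := 2) (by norm_num) θ

lemma norm_sq_le_sum_add_of_mem_ellipsoid {A : ℝ} (hA : 0 < A) (haS : ∀ j ∉ S, A ≤ a j)
    (hθ : θ ∈ ellipsoid a) : ‖θ‖ ^ 2 ≤ ∑ j ∈ S, θ j ^ 2 + (A ^ 2)⁻¹ := by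
  have htail : ∀ T : Finset ℕ+, ∑ j ∈ T \ S, θ j ^ 2 ≤ (A ^ 2)⁻¹ := fun T => by
    calc ∑ j ∈ T \ S, θ j ^ 2 ≤ ∑ j ∈ T \ S, (A ^ 2)⁻¹ * (a j ^ 2 * θ j ^ 2) := by
          refine Finset.sum_le_sum fun j hj => ?_
          have hAj := haS j (Finset.mem_sdiff.1 hj).2
          rw [inv_mul_eq_div, le_div_iff₀' (by positivity)]
          gcongr
      _ = (A ^ 2)⁻¹ * ∑ j ∈ T \ S, a j ^ 2 * θ j ^ 2 := by rw [Finset.mul_sum]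
      _ ≤ (A ^ 2)⁻¹ :=
          mul_le_of_le_one_right (by positivity) (sum_le_one_of_mem_ellipsoid hθ _)
  refine hasSum_le_of_sum_le (hasSum_sq θ) fun T => ?_
  calc ∑ j ∈ T, θ j ^ 2 = ∑ j ∈ T ∩ S, θ j ^ 2 + ∑ j ∈ T \ S, θ j ^ 2 :=
        (Finset.sum_inter_add_sum_sdiff T S _).symm
    _ ≤ ∑ j ∈ S, θ j ^ 2 + (A ^ 2)⁻¹ := by
        gcongr
        · exact Finset.inter_subset_right
        · exact htail T

lemma weighted_residualVar_sq_le {ε σ Q : ℝ} {j : ℕ+} (hd : 0 < d j) (hθ : θ ∈ ellipsoid a)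
    (hQ : 1 ≤ Q * (a j * d j) ^ 2) :
    ((d j ^ 2)⁻¹ * residualVar ε σ θ j) ^ 2 ≤
      2 * ε ^ 4 * (d j ^ 4)⁻¹ + 2 * (σ ^ 2 * Q) ^ 2 * (a j ^ 2 * θ j ^ 2) := by
  have haθ : a j ^ 2 * θ j ^ 2 ≤ 1 := by simpa using sum_le_one_of_mem_ellipsoid hθ {j}
  have hη : (d j ^ 2)⁻¹ * (σ * θ j) ^ 2 ≤ σ ^ 2 * Q * (a j ^ 2 * θ j ^ 2) := by
    rw [inv_mul_le_iff₀ (by positivity)]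
    calc (σ * θ j) ^ 2 ≤ (σ * θ j) ^ 2 * (Q * (a j * d j) ^ 2) :=
          le_mul_of_one_le_right (sq_nonneg _) hQ
      _ = _ := by ring
  calc ((d j ^ 2)⁻¹ * (ε ^ 2 + (σ * θ j) ^ 2)) ^ 2
      = ((d j ^ 2)⁻¹ * ε ^ 2 + (d j ^ 2)⁻¹ * (σ * θ j) ^ 2) ^ 2 := by ring
    _ ≤ 2 * (((d j ^ 2)⁻¹ * ε ^ 2) ^ 2 + ((d j ^ 2)⁻¹ * (σ * θ j) ^ 2) ^ 2) := add_sq_le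
    _ ≤ 2 * (((d j ^ 2)⁻¹ * ε ^ 2) ^ 2 + (σ ^ 2 * Q * (a j ^ 2 * θ j ^ 2)) ^ 2) := by gcongr
    _ = 2 * ε ^ 4 * (d j ^ 4)⁻¹ +
        2 * (σ ^ 2 * Q) ^ 2 * ((a j ^ 2 * θ j ^ 2) * (a j ^ 2 * θ j ^ 2)) := by
        field_simp
    _ ≤ 2 * ε ^ 4 * (d j ^ 4)⁻¹ + 2 * (σ ^ 2 * Q) ^ 2 * (a j ^ 2 * θ j ^ 2) :=
        add_le_add le_rfl (mul_le_mul_of_nonneg_left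
          (mul_le_of_le_one_left (by positivity) haθ) (by positivity))

lemma sum_weighted_residualVar_sq_le {ε σ P Q : ℝ} (hd : ∀ j, 0 < d j) (hθ : θ ∈ ellipsoid a)
    (hP : 0 ≤ P) (hQ : 0 ≤ Q) (hSP : ∑ j ∈ S, (d j ^ 4)⁻¹ ≤ P ^ 2)
    (hSQ : ∀ j ∈ S, 1 ≤ Q * (a j * d j) ^ 2) :
    ∑ j ∈ S, ((d j ^ 2)⁻¹ * residualVar ε σ θ j) ^ 2 ≤ (2 * (ε ^ 2 * P + σ ^ 2 * Q)) ^ 2 := by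
  calc ∑ j ∈ S, ((d j ^ 2)⁻¹ * residualVar ε σ θ j) ^ 2
      ≤ ∑ j ∈ S, (2 * ε ^ 4 * (d j ^ 4)⁻¹ + 2 * (σ ^ 2 * Q) ^ 2 * (a j ^ 2 * θ j ^ 2)) :=
        Finset.sum_le_sum fun j hj => weighted_residualVar_sq_le (hd j) hθ (hSQ j hj)
    _ = 2 * ε ^ 4 * ∑ j ∈ S, (d j ^ 4)⁻¹ +
        2 * (σ ^ 2 * Q) ^ 2 * ∑ j ∈ S, a j ^ 2 * θ j ^ 2 := by
        rw [Finset.sum_add_distrib, Finset.mul_sum, Finset.mul_sum]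
    _ ≤ 2 * ε ^ 4 * P ^ 2 + 2 * (σ ^ 2 * Q) ^ 2 * 1 := by
        gcongr
        exact sum_le_one_of_mem_ellipsoid hθ S
    _ ≤ (2 * (ε ^ 2 * P + σ ^ 2 * Q)) ^ 2 := by
        have hcross : 0 ≤ ε ^ 2 * P * (σ ^ 2 * Q) := by positivity
        nlinarith [sq_nonneg (ε ^ 2 * P), sq_nonneg (σ ^ 2 * Q)]

end Ellipsoid

section MinimaxRadius

variable {a d : ℕ+ → ℝ} {B : Set (ℕ+ → ℝ)} {α β ε σ : ℝ}

lemma minimaxRadius_sq_le_of_test {r : ℝ} (hr : 0 < r) (Ψ : Test) (hα : HasLevel a B ε σ α Ψ)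
    (hβ : ∀ θ₀ ∈ ellipsoid a, ∀ θ : L2, θ - θ₀ ∈ separated a r → ∀ b ∈ B,
      law ε σ θ b {x | Ψ.toFun θ₀ x = 0} ≤ ENNReal.ofReal β) :
    minimaxRadius a B α β ε σ ^ 2 ≤ ENNReal.ofReal (r ^ 2) := by
  rw [ENNReal.ofReal_pow hr.le]
  gcongr
  refine (iInf₂_le Ψ hα).trans ((iInf₂_le r hr).trans (iInf_le _ ?_))
  simp only [secondKindError, iSup_le_iff]
  exact fun θ₀ θ b h₀ hθ hb => hβ θ₀ h₀ θ hθ b hb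

lemma sum_sq_le_sum_weighted_sq {b : ℕ+ → ℝ} (hd : ∀ j, 0 < d j) (hdb : ∀ j, d j ≤ b j)
    (x : ℕ+ → ℝ) (S : Finset ℕ+) :
    ∑ j ∈ S, x j ^ 2 ≤ ∑ j ∈ S, (d j ^ 2)⁻¹ * (b j * x j) ^ 2 := by
  refine Finset.sum_le_sum fun j _ => ?_
  have hdj := hd j
  rw [inv_mul_eq_div, le_div_iff₀' (by positivity), mul_pow]
  gcongr
  exact hdb j

lemma minimaxRadius_sq_le {A P Q H : ℝ} {S : Finset ℕ+} (hH : 1 ≤ H) (hHα : 2 / H ^ 2 ≤ α)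
    (hHβ : 10 / H ≤ β) (hε : 0 < ε) (hA : 0 < A) (haS : ∀ j ∉ S, A ≤ a j) (hd : ∀ j, 0 < d j)
    (hdB : ∀ b ∈ B, ∀ j, d j ≤ b j) (hP : 0 < P) (hQ : 0 ≤ Q)
    (hSP : ∑ j ∈ S, (d j ^ 4)⁻¹ ≤ P ^ 2) (hSQ : ∀ j ∈ S, 1 ≤ Q * (a j * d j) ^ 2) :
    minimaxRadius a B α β ε σ ^ 2 ≤
      ENNReal.ofReal ((A ^ 2)⁻¹ + 4 * H * (ε ^ 2 * P + σ ^ 2 * Q)) := by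
  set q := 2 * (ε ^ 2 * P + σ ^ 2 * Q) with hq_def
  have hq : 0 < q := by positivity
  have hw (j : ℕ+) : 0 ≤ (d j ^ 2)⁻¹ := by positivity
  have hnoise {θ₀ : L2} (h₀ : θ₀ ∈ ellipsoid a) :
      ∑ j ∈ S, ((d j ^ 2)⁻¹ * residualVar ε σ θ₀ j) ^ 2 ≤ q ^ 2 :=
    sum_weighted_residualVar_sq_le hd h₀ hP.le hQ hSP hSQ
  have hr : 0 < (A ^ 2)⁻¹ + 2 * H * q := by positivity
  have hr_eq : (A ^ 2)⁻¹ + 4 * H * (ε ^ 2 * P + σ ^ 2 * Q) = √((A ^ 2)⁻¹ + 2 * H * q) ^ 2 := by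
    rw [Real.sq_sqrt hr.le, hq_def]
    ring
  rw [hr_eq]
  refine minimaxRadius_sq_le_of_test (Real.sqrt_pos.2 hr)
    (residualTest ε σ (fun j => (d j ^ 2)⁻¹) S (H * q)) (fun θ₀ h₀ b _ => ?_)
    fun θ₀ h₀ θ hθ b hb => ?_
  · exact (law_residualTest_eq_one_le hw hq (hnoise h₀) (by positivity)).trans
      (ENNReal.ofReal_le_ofReal hHα)
  · have hsep : 2 * H * q ≤ ∑ j ∈ S, (θ - θ₀) j ^ 2 := by
      have hnorm := norm_sq_le_sum_add_of_mem_ellipsoid hA haS hθ.1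
      linarith [Real.sqrt_le_iff.1 hθ.2 |>.2]
    exact (law_residualTest_eq_zero_le hw hq (hnoise h₀) hH
      (hsep.trans (sum_sq_le_sum_weighted_sq hd (hdB b hb) _ S))).trans
      (ENNReal.ofReal_le_ofReal hHβ)

end MinimaxRadius

section UpperRate

variable {α β C : ℝ} {a a' d : ℕ+ → ℝ} {B S : Set (ℕ+ → ℝ)} {rate rate' : ℝ → ℝ → ℝ}

lemma hasUpperRate_iff_eventually :
    HasUpperRate a B α β rate ↔ ∃ C > 0, ∀ᶠ p : ℝ × ℝ in 𝓝[>] 0 ×ˢ 𝓝[>] 0,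
      minimaxRadius a B α β p.1 p.2 ^ 2 ≤ ENNReal.ofReal (C * rate p.1 p.2) := by
  constructor
  · rintro ⟨ε₀, hε₀, σ₀, hσ₀, C, hC, hbound⟩
    refine ⟨C, hC, ?_⟩
    filter_upwards [prod_mem_prod (Ioo_mem_nhdsGT hε₀.1) (Ioo_mem_nhdsGT hσ₀.1)]
      with p ⟨hε, hσ⟩ using hbound p.1 p.2 hε.1 hε.2.le hσ.1 hσ.2.le
  · rintro ⟨C, hC, hbound⟩
    obtain ⟨δ, hδ, hbound⟩ := (nhdsGT_basis (0 : ℝ)).prod_self.eventually_iff.1 hbound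
    have hδ₀ : min (δ / 2) (1 / 2) ∈ Ioo (0 : ℝ) 1 :=
      ⟨by positivity, (min_le_right _ _).trans_lt (by norm_num)⟩
    have hlt : min (δ / 2) (1 / 2) < δ := (min_le_left _ _).trans_lt (half_lt_self hδ)
    exact ⟨_, hδ₀, _, hδ₀, C, hC, fun ε σ hε hε' hσ hσ' =>
      hbound (x := (ε, σ)) ⟨⟨hε, hε'.trans_lt hlt⟩, hσ, hσ'.trans_lt hlt⟩⟩

lemma HasUpperRate.mono (h : HasUpperRate a B α β rate)
    (hle : ∀ᶠ p : ℝ × ℝ in 𝓝[>] 0 ×ˢ 𝓝[>] 0, rate p.1 p.2 ≤ rate' p.1 p.2) :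
    HasUpperRate a B α β rate' := by
  obtain ⟨C, hC, hbound⟩ := hasUpperRate_iff_eventually.1 h
  refine hasUpperRate_iff_eventually.2 ⟨C, hC, ?_⟩
  filter_upwards [hbound, hle] with p hp hle using hp.trans (by gcongr)

lemma HasUpperRate.mono_max_right {f g g' : ℝ → ℝ}
    (h : HasUpperRate a B α β fun ε σ => max (f ε) (g σ))
    (hle : ∀ᶠ σ in 𝓝[>] (0 : ℝ), g σ ≤ g' σ) :
    HasUpperRate a B α β fun ε σ => max (f ε) (g' σ) := by
  refine h.mono ?_
  filter_upwards [hle.prod_inr (𝓝[>] 0)] with p hp using max_le_max le_rfl hp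

/-- The sequences in `S` are at least a common positive multiple of `d`: the half of `EquivOn S d`
on which upper bounds for the minimax radius rest. -/
def DominatesOn (S : Set (ℕ+ → ℝ)) (d : ℕ+ → ℝ) : Prop :=
  ∃ κ > 0, ∀ c ∈ S, ∀ j, κ * d j ≤ c j

lemma EquivOn.dominatesOn (h : EquivOn S d) (hd : ∀ j, 0 < d j) : DominatesOn S d := by
  obtain ⟨κ, _, hκ, -, hS⟩ := h
  exact ⟨κ, hκ, fun c hc j => (le_div_iff₀ (hd j)).1 (hS c hc j).1⟩

lemma SeqEquiv.dominatesOn_singleton (h : SeqEquiv a d) (hd : ∀ j, 0 < d j) :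
    DominatesOn {a} d := by
  obtain ⟨κ, _, hκ, -, ha⟩ := h
  exact ⟨κ, hκ, fun c hc j => (le_div_iff₀ (hd j)).1 (hc ▸ ha j).1⟩

lemma exists_minimaxRadius_sq_le (hα : 0 < α) (hβ : 0 < β) :
    ∃ K : ℝ, ∀ (a d : ℕ+ → ℝ) (B : Set (ℕ+ → ℝ)) (S : Finset ℕ+) (ε σ A P Q : ℝ),
      0 < ε → 0 < A → (∀ j ∉ S, A ≤ a j) → (∀ j, 0 < d j) → (∀ b ∈ B, ∀ j, d j ≤ b j) →
      0 < P → 0 ≤ Q → ∑ j ∈ S, (d j ^ 4)⁻¹ ≤ P ^ 2 → (∀ j ∈ S, 1 ≤ Q * (a j * d j) ^ 2) →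
      minimaxRadius a B α β ε σ ^ 2 ≤
        ENNReal.ofReal ((A ^ 2)⁻¹ + K * (ε ^ 2 * P + σ ^ 2 * Q)) := by
  have hα' : ∀ᶠ H : ℝ in atTop, 2 / H ^ 2 ≤ α :=
    (tendsto_const_nhds.div_atTop (tendsto_pow_atTop two_ne_zero)).eventually_le_const hα
  have hβ' : ∀ᶠ H : ℝ in atTop, 10 / H ≤ β :=
    (tendsto_const_nhds.div_atTop tendsto_id).eventually_le_const hβ
  obtain ⟨H, hH, hHα, hHβ⟩ := ((eventually_ge_atTop 1).and (hα'.and hβ')).exists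
  exact ⟨4 * H, fun a d B S ε σ A P Q hε hA haS hd hdB hP hQ hSP hSQ =>
    minimaxRadius_sq_le hH hHα hHβ hε hA haS hd hdB hP hQ hSP hSQ⟩

lemma exists_minimaxRadius_sq_le_of_dominatesOn (hα : 0 < α) (hβ : 0 < β) (hd : ∀ j, 0 < d j)
    (ha' : ∀ j, 0 < a' j) (hmono : Monotone a') (hB : DominatesOn B d) (ha : DominatesOn {a} a') :
    ∃ K > 0, ∀ (D : ℕ+) (P Q ε σ : ℝ), 0 < ε → 0 < P → 0 ≤ Q →
      ∑ j ∈ Finset.Icc 1 D, (d j ^ 4)⁻¹ ≤ P ^ 2 → (∀ j ≤ D, 1 ≤ Q * (a' j * d j) ^ 2) →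
      minimaxRadius a B α β ε σ ^ 2 ≤
        ENNReal.ofReal (K * ((a' D ^ 2)⁻¹ + ε ^ 2 * P + σ ^ 2 * Q)) := by
  obtain ⟨κ, hκ, hκB⟩ := hB
  obtain ⟨ν, hν, hνa⟩ := ha
  have haν (j : ℕ+) : ν * a' j ≤ a j := hνa a rfl j
  obtain ⟨K, hbound⟩ := exists_minimaxRadius_sq_le hα hβ
  set L := max (ν ^ 2)⁻¹ (max (K * (κ ^ 2)⁻¹) (K * ((ν * κ) ^ 2)⁻¹)) with hL
  refine ⟨L, by positivity, fun D P Q ε σ hε hP hQ hSP hSQ => ?_⟩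
  have htail : ∀ j ∉ Finset.Icc 1 D, ν * a' D ≤ a j := fun j hj => by
    have hDj : D ≤ j := by
      by_contra! hlt
      exact hj (Finset.mem_Icc.2 ⟨one_le, hlt.le⟩)
    exact (mul_le_mul_of_nonneg_left (hmono hDj) hν.le).trans (haν j)
  have hSP' : ∑ j ∈ Finset.Icc 1 D, ((κ * d j) ^ 4)⁻¹ ≤ ((κ ^ 2)⁻¹ * P) ^ 2 := by
    simp only [mul_pow, mul_inv, ← Finset.mul_sum]
    calc (κ ^ 4)⁻¹ * ∑ j ∈ Finset.Icc 1 D, (d j ^ 4)⁻¹ ≤ (κ ^ 4)⁻¹ * P ^ 2 := by gcongr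
      _ = ((κ ^ 2)⁻¹) ^ 2 * P ^ 2 := by ring
  have hSQ' : ∀ j ∈ Finset.Icc 1 D, 1 ≤ ((ν * κ) ^ 2)⁻¹ * Q * (a j * (κ * d j)) ^ 2 := by
    intro j hj
    have ha'j := ha' j
    have hdj := hd j
    calc 1 ≤ Q * (a' j * d j) ^ 2 := hSQ j (Finset.mem_Icc.1 hj).2
      _ = ((ν * κ) ^ 2)⁻¹ * Q * (ν * a' j * (κ * d j)) ^ 2 := by field_simp
      _ ≤ ((ν * κ) ^ 2)⁻¹ * Q * (a j * (κ * d j)) ^ 2 := by gcongr; exact haν j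
  have ha'D := ha' D
  refine (hbound a (fun j => κ * d j) B (Finset.Icc 1 D) ε σ (ν * a' D) ((κ ^ 2)⁻¹ * P)
    (((ν * κ) ^ 2)⁻¹ * Q) hε (by positivity) htail (fun j => mul_pos hκ (hd j)) hκB
    (by positivity) (by positivity) hSP' hSQ').trans (ENNReal.ofReal_le_ofReal ?_)
  calc ((ν * a' D) ^ 2)⁻¹ + K * (ε ^ 2 * ((κ ^ 2)⁻¹ * P) + σ ^ 2 * (((ν * κ) ^ 2)⁻¹ * Q))
      = (ν ^ 2)⁻¹ * (a' D ^ 2)⁻¹ + K * (κ ^ 2)⁻¹ * (ε ^ 2 * P) +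
          K * ((ν * κ) ^ 2)⁻¹ * (σ ^ 2 * Q) := by rw [mul_pow, mul_inv]; ring
    _ ≤ L * (a' D ^ 2)⁻¹ + L * (ε ^ 2 * P) + L * (σ ^ 2 * Q) := by
        gcongr <;> simp [hL]
    _ = L * ((a' D ^ 2)⁻¹ + ε ^ 2 * P + σ ^ 2 * Q) := by ring

lemma hasUpperRate_of_truncation {P Q : ℕ+ → ℝ} (hα : 0 < α) (hβ : 0 < β) (hd : ∀ j, 0 < d j)
    (ha' : ∀ j, 0 < a' j) (hmono : Monotone a') (hB : DominatesOn B d) (ha : DominatesOn {a} a')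
    (hP : ∀ D, 0 < P D) (hQ : ∀ D, 0 ≤ Q D)
    (hSP : ∀ D, ∑ j ∈ Finset.Icc 1 D, (d j ^ 4)⁻¹ ≤ P D ^ 2)
    (hSQ : ∀ D, ∀ j ≤ D, 1 ≤ Q D * (a' j * d j) ^ 2) (hC : 0 < C)
    (hbalance : ∀ᶠ p : ℝ × ℝ in 𝓝[>] 0 ×ˢ 𝓝[>] 0, ∃ D,
      (a' D ^ 2)⁻¹ + p.1 ^ 2 * P D + p.2 ^ 2 * Q D ≤ C * rate p.1 p.2) :
    HasUpperRate a B α β rate := by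
  obtain ⟨K, hK, hbound⟩ :=
    exists_minimaxRadius_sq_le_of_dominatesOn hα hβ hd ha' hmono hB ha
  refine hasUpperRate_iff_eventually.2 ⟨K * C, mul_pos hK hC, ?_⟩
  filter_upwards [hbalance, prod_mem_prod self_mem_nhdsWithin self_mem_nhdsWithin]
    with p ⟨D, hD⟩ hp
  refine (hbound D (P D) (Q D) p.1 p.2 hp.1 (hP D) (hQ D) (hSP D) (hSQ D)).trans
    (ENNReal.ofReal_le_ofReal ?_)
  rw [mul_assoc]
  gcongr

end UpperRate

section Truncation

lemma exists_pnat_floor {x : ℝ} (hx : 1 ≤ x) :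
    ∃ D : ℕ+, x / 2 ≤ (D : ℝ) ∧ x - 1 ≤ (D : ℝ) ∧ (D : ℝ) ≤ x := by
  have hlt := Nat.lt_floor_add_one x
  have hone : (1 : ℝ) ≤ ⌊x⌋₊ := by exact_mod_cast Nat.floor_pos.2 hx
  refine ⟨⟨⌊x⌋₊, Nat.floor_pos.2 hx⟩, ?_, ?_, Nat.floor_le (by positivity)⟩ <;>
    simp only [PNat.mk_coe] <;> linarith

lemma sum_pow_Icc_one_le {q : ℝ} (hq : 1 < q) (D : ℕ+) :
    ∑ j ∈ Finset.Icc 1 D, q ^ (j : ℕ) ≤ q / (q - 1) * q ^ (D : ℕ) := by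
  have : 0 < q - 1 := sub_pos.2 hq
  calc ∑ j ∈ Finset.Icc 1 D, q ^ (j : ℕ) = ∑ n ∈ Finset.Icc 1 (D : ℕ), q ^ n := by
        have hIcc : Finset.Icc 1 (D : ℕ) =
            (Finset.Icc 1 D).map ⟨PNat.val, PNat.coe_injective⟩ :=
          (PNat.map_subtype_embedding_Icc 1 D).symm
        simp only [hIcc, Finset.sum_map, Function.Embedding.coeFn_mk]
    _ = (q ^ ((D : ℕ) + 1) - q ^ 1) / (q - 1) := by
        rw [← geom_sum_Ico hq.ne' (by omega)]
        rfl
    _ ≤ q ^ ((D : ℕ) + 1) / (q - 1) := by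
        gcongr
        simpa using hq.le.trans' zero_le_one
    _ = q / (q - 1) * q ^ (D : ℕ) := by ring

lemma sum_rpow_neg_pow_four_inv_le {t : ℝ} (ht : 0 < t) (D : ℕ+) :
    ∑ j ∈ Finset.Icc 1 D, (((j : ℝ) ^ (-t)) ^ 4)⁻¹ ≤ ((D : ℝ) ^ (2 * t + 1 / 2)) ^ 2 := by
  have hD : (0 : ℝ) < D := by positivity
  calc ∑ j ∈ Finset.Icc 1 D, (((j : ℝ) ^ (-t)) ^ 4)⁻¹
      ≤ ∑ j ∈ Finset.Icc 1 D, (((D : ℝ) ^ (-t)) ^ 4)⁻¹ := by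
        refine Finset.sum_le_sum fun j hj => ?_
        have hjD : (j : ℝ) ≤ D := by exact_mod_cast (Finset.mem_Icc.1 hj).2
        gcongr ?_⁻¹
        gcongr ?_ ^ 4
        exact Real.rpow_le_rpow_of_nonpos (by positivity) hjD (by linarith)
    _ = (D : ℝ) * (D : ℝ) ^ (4 * t) := by
        rw [← Real.rpow_mul_natCast hD.le, ← Real.rpow_neg hD.le, Finset.sum_const]
        simp only [PNat.card_Icc, nsmul_eq_mul]
        congr 2
        push_cast; ring
    _ = ((D : ℝ) ^ (2 * t + 1 / 2)) ^ 2 := by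
        rw [← Real.rpow_mul_natCast hD.le, ← Real.rpow_one_add' hD.le (by positivity)]
        congr 1; push_cast; ring

lemma sum_exp_neg_pow_four_inv_le {t : ℝ} (ht : 0 < t) (D : ℕ+) :
    ∑ j ∈ Finset.Icc 1 D, (Real.exp (-(j * t)) ^ 4)⁻¹ ≤
      (√(Real.exp (4 * t) / (Real.exp (4 * t) - 1)) * Real.exp (D * (2 * t))) ^ 2 := by
  have hq : 1 < Real.exp (4 * t) := Real.one_lt_exp_iff.2 (by positivity)
  have hterm (j : ℕ+) : (Real.exp (-(j * t)) ^ 4)⁻¹ = Real.exp (4 * t) ^ (j : ℕ) := by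
    rw [← Real.exp_nat_mul, ← Real.exp_nat_mul, ← Real.exp_neg]
    congr 1; push_cast; ring
  have hsq : Real.exp (D * (2 * t)) ^ 2 = Real.exp (4 * t) ^ (D : ℕ) := by
    rw [← Real.exp_nat_mul, ← Real.exp_nat_mul]
    congr 1; push_cast; ring
  rw [mul_pow, Real.sq_sqrt (div_nonneg (Real.exp_pos _).le (sub_pos.2 hq).le), hsq]
  simpa only [hterm] using sum_pow_Icc_one_le hq D

end Truncation

section Balance

variable {s t τ c G N ε σ : ℝ}

lemma two_sub_two_mul_max_div_eq (ht : 0 < t) :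
    2 - 2 * max (t - s) 0 / t = 2 * min (s / t) 1 := by
  rcases le_total s t with h | h
  · rw [max_eq_left (by linarith), min_eq_left ((div_le_one ht).2 h)]
    field_simp; ring
  · rw [max_eq_right (by linarith), min_eq_right ((one_le_div ht).2 h)]
    simp

lemma sq_mul_rpow_rpow_neg {x p q : ℝ} (hx : 0 < x) :
    x ^ 2 * (x ^ (-p)) ^ q = x ^ (2 - p * q) := by
  rw [← Real.rpow_mul hx.le, ← Real.rpow_natCast x 2, ← Real.rpow_add hx]
  congr 1; push_cast; ring

/-- The frequency scale at which the squared bias `x^(-2s)` reaches the noise terms `ε² x^τ` and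
`σ² x^(2t - 2s)`. -/
def balancedScale (s t τ ε σ : ℝ) : ℝ :=
  min (ε ^ (-(2 / (2 * s + τ)))) (σ ^ (-(1 / t)))

lemma balancedScale_pos (hε : 0 < ε) (hσ : 0 < σ) : 0 < balancedScale s t τ ε σ :=
  lt_min (Real.rpow_pos_of_pos hε _) (Real.rpow_pos_of_pos hσ _)

lemma balancedScale_rpow_neg_le (hε : 0 < ε) (hσ : 0 < σ) (hσ' : σ ≤ 1) :
    balancedScale s t τ ε σ ^ (-(2 * s)) ≤
      max (ε ^ (4 * s / (2 * s + τ))) (σ ^ (2 * min (s / t) 1)) := by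
  rcases min_choice (ε ^ (-(2 / (2 * s + τ)))) (σ ^ (-(1 / t))) with h | h <;>
    rw [balancedScale, h]
  · refine le_max_of_le_left (le_of_eq ?_)
    rw [← Real.rpow_mul hε.le]
    congr 1; ring
  · refine le_max_of_le_right ?_
    rw [← Real.rpow_mul hσ.le]
    refine Real.rpow_le_rpow_of_exponent_ge hσ hσ' ?_
    calc 2 * min (s / t) 1 ≤ 2 * (s / t) := by gcongr; exact min_le_left _ _
      _ = -(1 / t) * -(2 * s) := by ring

lemma sq_mul_rpow_le_of_le_balancedScale (hs : 0 < s) (hτ : 0 ≤ τ) (hε : 0 < ε) (hN : 0 ≤ N)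
    (hNx : N ≤ balancedScale s t τ ε σ) : ε ^ 2 * N ^ τ ≤ ε ^ (4 * s / (2 * s + τ)) := by
  calc ε ^ 2 * N ^ τ ≤ ε ^ 2 * (ε ^ (-(2 / (2 * s + τ)))) ^ τ := by
        gcongr
        exact hNx.trans (min_le_left _ _)
    _ = ε ^ (4 * s / (2 * s + τ)) := by
        rw [sq_mul_rpow_rpow_neg hε]
        congr 1; field_simp; ring

lemma sq_mul_rpow_max_le_of_le_balancedScale (ht : 0 < t) (hσ : 0 < σ) (hN : 0 ≤ N)
    (hNx : N ≤ balancedScale s t τ ε σ) :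
    σ ^ 2 * N ^ (2 * max (t - s) 0) ≤ σ ^ (2 * min (s / t) 1) := by
  calc σ ^ 2 * N ^ (2 * max (t - s) 0) ≤ σ ^ 2 * (σ ^ (-(1 / t))) ^ (2 * max (t - s) 0) := by
        gcongr
        exact hNx.trans (min_le_right _ _)
    _ = σ ^ (2 * min (s / t) 1) := by
        rw [sq_mul_rpow_rpow_neg hσ, ← two_sub_two_mul_max_div_eq ht]
        congr 1; ring

lemma balance_le (hs : 0 < s) (ht : 0 < t) (hτ : 0 ≤ τ) (hc : 0 < c) (hG : 0 ≤ G) (hε : 0 < ε)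
    (hσ : 0 < σ) (hσ' : σ ≤ 1) (hxN : balancedScale s t τ ε σ / c ≤ N)
    (hNx : N ≤ balancedScale s t τ ε σ) :
    N ^ (-(2 * s)) + ε ^ 2 * (G * N ^ τ) + σ ^ 2 * N ^ (2 * max (t - s) 0) ≤
      (c ^ (2 * s) + G + 1) * max (ε ^ (4 * s / (2 * s + τ))) (σ ^ (2 * min (s / t) 1)) := by
  set x := balancedScale s t τ ε σ
  set R := max (ε ^ (4 * s / (2 * s + τ))) (σ ^ (2 * min (s / t) 1))
  have hx : 0 < x := balancedScale_pos hε hσ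
  have hN : 0 < N := hxN.trans_lt' (by positivity)
  have hbias : N ^ (-(2 * s)) ≤ c ^ (2 * s) * R := by
    calc N ^ (-(2 * s)) ≤ (x / c) ^ (-(2 * s)) :=
          Real.rpow_le_rpow_of_nonpos (by positivity) hxN (by linarith)
      _ = c ^ (2 * s) * x ^ (-(2 * s)) := by
          rw [Real.div_rpow hx.le hc.le, Real.rpow_neg hc.le, div_inv_eq_mul, mul_comm]
      _ ≤ c ^ (2 * s) * R := by
          gcongr
          exact balancedScale_rpow_neg_le hε hσ hσ'
  have hY : ε ^ 2 * (G * N ^ τ) ≤ G * R := by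
    rw [mul_left_comm]
    gcongr
    exact (sq_mul_rpow_le_of_le_balancedScale hs hτ hε hN.le hNx).trans (le_max_left _ _)
  have hX : σ ^ 2 * N ^ (2 * max (t - s) 0) ≤ R :=
    (sq_mul_rpow_max_le_of_le_balancedScale ht hσ hN.le hNx).trans (le_max_right _ _)
  linarith

lemma eventually_le_balancedScale (hs : 0 < s) (ht : 0 < t) (hτ : 0 ≤ τ) (x₀ : ℝ) :
    ∀ᶠ p : ℝ × ℝ in 𝓝[>] 0 ×ˢ 𝓝[>] 0, x₀ ≤ balancedScale s t τ p.1 p.2 := by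
  have htop {q : ℝ} (hq : 0 < q) : ∀ᶠ δ in 𝓝[>] (0 : ℝ), x₀ ≤ δ ^ (-q) :=
    (tendsto_rpow_neg_nhdsGT_zero (neg_lt_zero.2 hq)).eventually_ge_atTop x₀
  filter_upwards [(htop (by positivity : 0 < 2 / (2 * s + τ))).prod_inl (𝓝[>] 0),
    (htop (by positivity : 0 < 1 / t)).prod_inr (𝓝[>] 0)] with p hε hσ using le_min hε hσ

end Balance

section PowersOfOneSequence

variable {α β s t τ c G x₀ : ℝ} {a N : ℕ+ → ℝ} {B : Set (ℕ+ → ℝ)}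

lemma one_le_rpow_mul_rpow_sq {x y : ℝ} (hx : 1 ≤ x) (hxy : x ≤ y) :
    1 ≤ y ^ (2 * max (t - s) 0) * (x ^ s * x ^ (-t)) ^ 2 := by
  have hx₀ : 0 < x := by positivity
  have hinv : (x ^ s * x ^ (-t)) ^ 2 = (x ^ (2 * (t - s)))⁻¹ := by
    rw [← Real.rpow_add hx₀, ← Real.rpow_mul_natCast hx₀.le, ← Real.rpow_neg hx₀.le]
    congr 1; push_cast; ring
  rw [hinv, ← div_eq_mul_inv, one_le_div (by positivity)]
  calc x ^ (2 * (t - s)) ≤ x ^ (2 * max (t - s) 0) :=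
        Real.rpow_le_rpow_of_exponent_le hx (by gcongr; exact le_max_left _ _)
    _ ≤ y ^ (2 * max (t - s) 0) := by gcongr

lemma hasUpperRate_of_rpow (hα : 0 < α) (hβ : 0 < β) (hs : 0 < s) (ht : 0 < t) (hτ : 0 ≤ τ)
    (hc : 0 < c) (hG : 0 < G) (hN : ∀ j, 1 ≤ N j) (hmono : Monotone N)
    (hdense : ∀ x ≥ x₀, ∃ D, x / c ≤ N D ∧ N D ≤ x)
    (hsum : ∀ D, ∑ j ∈ Finset.Icc 1 D, ((N j ^ (-t)) ^ 4)⁻¹ ≤ (G * N D ^ τ) ^ 2)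
    (hB : DominatesOn B fun j => N j ^ (-t)) (ha : DominatesOn {a} fun j => N j ^ s) :
    HasUpperRate a B α β fun ε σ =>
      max (ε ^ (4 * s / (2 * s + τ))) (σ ^ (2 * min (s / t) 1)) := by
  have hN₀ (j : ℕ+) : 0 < N j := one_pos.trans_le (hN j)
  have hpow (r : ℝ) (j : ℕ+) : 0 < N j ^ r := Real.rpow_pos_of_pos (hN₀ j) r
  have hNs : Monotone fun j => N j ^ s := fun i j hij =>
    Real.rpow_le_rpow (hN₀ i).le (hmono hij) hs.le
  refine hasUpperRate_of_truncation (C := c ^ (2 * s) + G + 1) hα hβ (hpow _) (hpow _) hNs hB ha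
    (fun D => mul_pos hG (hpow τ D)) (fun D => (hpow (2 * max (t - s) 0) D).le) hsum
    (fun D j hj => one_le_rpow_mul_rpow_sq (hN j) (hmono hj)) (by positivity) ?_
  filter_upwards [eventually_le_balancedScale hs ht hτ x₀,
    prod_mem_prod (Ioc_mem_nhdsGT one_pos) (Ioc_mem_nhdsGT one_pos)] with ⟨ε, σ⟩ hx ⟨hε, hσ⟩
  obtain ⟨D, hxD, hDx⟩ := hdense _ hx
  have hbias : ((N D ^ s) ^ 2)⁻¹ = N D ^ (-(2 * s)) := by
    rw [← Real.rpow_mul_natCast (hN₀ D).le, ← Real.rpow_neg (hN₀ D).le, mul_comm s]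
    rfl
  exact ⟨D, hbias ▸ balance_le hs ht hτ hc hG.le hε.1 hσ.1 hσ.2 hxD hDx⟩

end PowersOfOneSequence

section Rates

variable {α β s t : ℝ} {a : ℕ+ → ℝ} {B : Set (ℕ+ → ℝ)}

lemma hasUpperRate_rpow_rpow (hα : 0 < α) (hβ : 0 < β) (hs : 0 < s) (ht : 0 < t)
    (hB : DominatesOn B fun j => (j : ℝ) ^ (-t)) (ha : DominatesOn {a} fun j => (j : ℝ) ^ s) :
    HasUpperRate a B α β fun ε σ =>
      max (ε ^ (4 * s / (2 * s + 2 * t + 1 / 2))) (σ ^ (2 * min (s / t) 1)) := by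
  have hdense : ∀ x ≥ (1 : ℝ), ∃ D : ℕ+, x / 2 ≤ (D : ℝ) ∧ (D : ℝ) ≤ x := fun x hx =>
    let ⟨D, hxD, _, hDx⟩ := exists_pnat_floor hx
    ⟨D, hxD, hDx⟩
  simpa only [add_assoc] using hasUpperRate_of_rpow (τ := 2 * t + 1 / 2) (c := 2) (G := 1) hα hβ
    hs ht (by positivity) two_pos one_pos (fun j => by exact_mod_cast one_le (a := j))
    (fun i j hij => by exact_mod_cast hij) hdense
    (fun D => by simpa only [one_mul] using sum_rpow_neg_pow_four_inv_le ht D) hB ha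

lemma sqrt_exp_div_pos (ht : 0 < t) : 0 < √(Real.exp (4 * t) / (Real.exp (4 * t) - 1)) := by
  have hq : 1 < Real.exp (4 * t) := Real.one_lt_exp_iff.2 (by positivity)
  exact Real.sqrt_pos.2 (div_pos (Real.exp_pos _) (sub_pos.2 hq))

lemma hasUpperRate_exp_exp (hα : 0 < α) (hβ : 0 < β) (hs : 0 < s) (ht : 0 < t)
    (hB : DominatesOn B fun j => Real.exp (-(j * t)))
    (ha : DominatesOn {a} fun j => Real.exp (j * s)) :
    HasUpperRate a B α β fun ε σ =>
      max (ε ^ (2 * s / (s + t))) (σ ^ (2 * min (s / t) 1)) := by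
  have hdense : ∀ x ≥ Real.exp 1, ∃ D : ℕ+,
      x / Real.exp 1 ≤ Real.exp D ∧ Real.exp D ≤ x := fun x hx => by
    have hx₀ : 0 < x := (Real.exp_pos 1).trans_le hx
    obtain ⟨D, -, hxD, hDx⟩ := exists_pnat_floor ((Real.le_log_iff_exp_le hx₀).2 hx)
    refine ⟨D, ?_, (Real.le_log_iff_exp_le hx₀).1 hDx⟩
    rw [← Real.exp_log hx₀, ← Real.exp_sub]
    exact Real.exp_le_exp.2 hxD
  have hexponent : 4 * s / (2 * s + 2 * t) = 2 * s / (s + t) := by field_simp; norm_num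
  simp only [← mul_neg, Real.exp_mul] at hB ha
  refine hexponent ▸ hasUpperRate_of_rpow hα hβ hs ht (by positivity) (Real.exp_pos 1)
    (sqrt_exp_div_pos ht) (fun j => Real.one_le_exp (by positivity))
    (fun i j hij => Real.exp_le_exp.2 (by exact_mod_cast hij)) hdense (fun D => ?_) hB ha
  simpa only [← Real.exp_mul, mul_neg] using sum_exp_neg_pow_four_inv_le ht D

lemma rpow_le_const_mul_exp {p x : ℝ} (hp : 0 < p) (hx : 0 ≤ x) :
    x ^ p ≤ p ^ p * Real.exp x := by
  have hlin : x / p ≤ Real.exp (x / p) := by linarith [Real.add_one_le_exp (x / p)]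
  have hpow := Real.rpow_le_rpow (by positivity) hlin hp.le
  rwa [Real.div_rpow hx hp.le, ← Real.exp_mul, div_mul_cancel₀ _ hp.ne',
    div_le_iff₀' (by positivity)] at hpow

lemma eventually_le_log_one_div (x₀ : ℝ) :
    ∀ᶠ δ in 𝓝[>] (0 : ℝ), x₀ ≤ Real.log (1 / δ) := by
  simpa only [one_div, Real.log_inv, Function.comp_def] using
    (tendsto_neg_atBot_atTop.comp Real.tendsto_log_nhdsGT_zero).eventually_ge_atTop x₀

lemma one_le_mul_exp_mul_rpow_neg_sq (hs : 0 < s) (ht : 0 < t) {x : ℝ} (hx : 0 < x) :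
    1 ≤ ((t / s) ^ t) ^ 2 * (Real.exp (x * s) * x ^ (-t)) ^ 2 := by
  rw [← mul_pow]
  refine one_le_pow₀ ?_
  have hexp := rpow_le_const_mul_exp ht (x := x * s) (by positivity)
  rw [Real.mul_rpow hx.le hs.le] at hexp
  rw [Real.div_rpow ht.le hs.le, Real.rpow_neg hx.le]
  calc 1 ≤ t ^ t * Real.exp (x * s) / (x ^ t * s ^ t) := (one_le_div (by positivity)).2 hexp
    _ = t ^ t / s ^ t * (Real.exp (x * s) * (x ^ t)⁻¹) := by field_simp

lemma exp_sq_inv_add_le_mul_log_rpow {τ ε x : ℝ} (hs : 0 < s) (hτ : 0 ≤ τ) (hε : 0 < ε)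
    (hlog : 1 ≤ Real.log (1 / ε)) (hx : 0 ≤ x) (hxl : Real.log (1 / ε) / s - 1 ≤ x)
    (hxu : x ≤ Real.log (1 / ε) / s) :
    (Real.exp (x * s) ^ 2)⁻¹ + ε ^ 2 * x ^ τ ≤
      (Real.exp (2 * s) + (s ^ τ)⁻¹) * (ε ^ 2 * Real.log (1 / ε) ^ τ) := by
  set L := Real.log (1 / ε) with hL
  have hεL : ε = Real.exp (-L) := by rw [hL, one_div, Real.log_inv, neg_neg, Real.exp_log hε]
  have hbias : (Real.exp (x * s) ^ 2)⁻¹ ≤ Real.exp (2 * s) * (ε ^ 2 * L ^ τ) := by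
    calc (Real.exp (x * s) ^ 2)⁻¹ = Real.exp (-(2 * (x * s))) := by
          rw [← Real.exp_nat_mul, ← Real.exp_neg]; norm_cast
      _ ≤ Real.exp (2 * s) * ε ^ 2 := by
          rw [hεL, ← Real.exp_nat_mul, ← Real.exp_add, Real.exp_le_exp]
          rw [sub_le_iff_le_add, div_le_iff₀ hs] at hxl
          push_cast; linarith
      _ ≤ Real.exp (2 * s) * (ε ^ 2 * L ^ τ) := by
          gcongr
          exact le_mul_of_one_le_right (by positivity) (Real.one_le_rpow hlog hτ)
  have hnoise : ε ^ 2 * x ^ τ ≤ (s ^ τ)⁻¹ * (ε ^ 2 * L ^ τ) := by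
    calc ε ^ 2 * x ^ τ ≤ ε ^ 2 * (L / s) ^ τ := by gcongr
      _ = (s ^ τ)⁻¹ * (ε ^ 2 * L ^ τ) := by
          rw [Real.div_rpow (by positivity) hs.le]; ring
  linarith

lemma hasUpperRate_rpow_exp (hα : 0 < α) (hβ : 0 < β) (hs : 0 < s) (ht : 0 < t)
    (hB : DominatesOn B fun j => (j : ℝ) ^ (-t)) (ha : DominatesOn {a} fun j => Real.exp (j * s)) :
    HasUpperRate a B α β fun ε σ =>
      max (ε ^ 2 * Real.log (1 / ε) ^ (2 * t + 1 / 2)) (σ ^ 2) := by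
  set τ := 2 * t + 1 / 2
  set Q := ((t / s) ^ t) ^ 2
  refine hasUpperRate_of_truncation (C := Real.exp (2 * s) + (s ^ τ)⁻¹ + Q) (Q := fun _ => Q) hα hβ
    (fun j => by positivity) (fun j => by positivity)
    (fun i j hij => Real.exp_le_exp.2 (by gcongr; exact_mod_cast hij)) hB ha
    (fun D => by positivity) (fun _ => by positivity) (sum_rpow_neg_pow_four_inv_le ht)
    (fun D j _ => one_le_mul_exp_mul_rpow_neg_sq hs ht (by positivity)) (by positivity) ?_
  filter_upwards [(eventually_le_log_one_div (max 1 s)).prod_inl (𝓝[>] 0),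
    prod_mem_prod self_mem_nhdsWithin univ_mem] with ⟨ε, σ⟩ hlog ⟨hε, _⟩
  obtain ⟨D, -, hDl, hDu⟩ :=
    exists_pnat_floor ((one_le_div hs).2 ((le_max_right _ _).trans hlog))
  refine ⟨D, ?_⟩
  have hYterm := exp_sq_inv_add_le_mul_log_rpow hs (by positivity : 0 ≤ τ) hε
    ((le_max_left _ _).trans hlog) (by positivity) hDl hDu
  calc (Real.exp (D * s) ^ 2)⁻¹ + ε ^ 2 * (D : ℝ) ^ τ + σ ^ 2 * Q
      ≤ (Real.exp (2 * s) + (s ^ τ)⁻¹) * (ε ^ 2 * Real.log (1 / ε) ^ τ) + Q * σ ^ 2 := by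
        rw [mul_comm Q]
        gcongr
    _ ≤ (Real.exp (2 * s) + (s ^ τ)⁻¹) * max (ε ^ 2 * Real.log (1 / ε) ^ τ) (σ ^ 2) +
          Q * max (ε ^ 2 * Real.log (1 / ε) ^ τ) (σ ^ 2) := by
        gcongr
        · exact le_max_left _ _
        · exact le_max_right _ _
    _ = _ := by ring

lemma exp_neg_le_const_mul_rpow_neg {p x : ℝ} (hp : 0 < p) (hx : 0 < x) :
    Real.exp (-x) ≤ p ^ p * x ^ (-p) := by
  rw [Real.rpow_neg hx.le, ← div_eq_mul_inv, le_div_iff₀ (by positivity), Real.exp_neg,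
    inv_mul_le_iff₀ (Real.exp_pos _), mul_comm]
  exact rpow_le_const_mul_exp hp hx.le

lemma rpow_sq_inv_add_le_mul_log_rpow_neg {K δ x : ℝ} (hs : 0 < s) (ht : 0 < t) (hK : 0 ≤ K)
    (hδ : 0 < δ) (hlog : 0 < Real.log (1 / δ)) (hxl : Real.log (1 / δ) / (2 * t) / 2 ≤ x)
    (hxu : x ≤ Real.log (1 / δ) / (2 * t)) :
    ((x ^ s) ^ 2)⁻¹ + δ ^ 2 * (K * Real.exp (x * (2 * t))) ≤
      ((4 * t) ^ (2 * s) + K * (2 * s) ^ (2 * s)) * Real.log (1 / δ) ^ (-(2 * s)) := by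
  set L := Real.log (1 / δ) with hL
  have hδL : δ = Real.exp (-L) := by rw [hL, one_div, Real.log_inv, neg_neg, Real.exp_log hδ]
  have hx : 0 < x := hxl.trans_lt' (by positivity)
  have hbias : ((x ^ s) ^ 2)⁻¹ ≤ (4 * t) ^ (2 * s) * L ^ (-(2 * s)) := by
    calc ((x ^ s) ^ 2)⁻¹ = x ^ (-(2 * s)) := by
          rw [← Real.rpow_mul_natCast hx.le, ← Real.rpow_neg hx.le, mul_comm s]
          rfl
      _ ≤ (L / (4 * t)) ^ (-(2 * s)) := by
          refine Real.rpow_le_rpow_of_nonpos (by positivity) (hxl.trans' (le_of_eq ?_))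
            (by linarith)
          rw [div_div]; ring
      _ = (4 * t) ^ (2 * s) * L ^ (-(2 * s)) := by
          rw [Real.div_rpow hlog.le (by positivity), Real.rpow_neg (x := 4 * t) (by positivity),
            div_inv_eq_mul, mul_comm]
  have hnoise : δ ^ 2 * Real.exp (x * (2 * t)) ≤ (2 * s) ^ (2 * s) * L ^ (-(2 * s)) := by
    calc δ ^ 2 * Real.exp (x * (2 * t)) ≤ δ ^ 2 * Real.exp L := by
          gcongr
          exact (le_div_iff₀ (by positivity)).1 hxu
      _ = Real.exp (-L) := by
          rw [hδL, ← Real.exp_nat_mul, ← Real.exp_add]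
          congr 1; push_cast; ring
      _ ≤ (2 * s) ^ (2 * s) * L ^ (-(2 * s)) :=
          exp_neg_le_const_mul_rpow_neg (by positivity) hlog
  calc ((x ^ s) ^ 2)⁻¹ + δ ^ 2 * (K * Real.exp (x * (2 * t)))
      = ((x ^ s) ^ 2)⁻¹ + K * (δ ^ 2 * Real.exp (x * (2 * t))) := by ring
    _ ≤ (4 * t) ^ (2 * s) * L ^ (-(2 * s)) + K * ((2 * s) ^ (2 * s) * L ^ (-(2 * s))) := by gcongr
    _ = _ := by ring

lemma one_le_exp_mul_rpow_mul_exp_sq (hs : 0 ≤ s) (ht : 0 ≤ t) {x y : ℝ} (hx : 1 ≤ x)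
    (hxy : x ≤ y) : 1 ≤ Real.exp (y * (2 * t)) * (x ^ s * Real.exp (-(x * t))) ^ 2 := by
  calc 1 ≤ Real.exp ((y - x) * (2 * t)) :=
        Real.one_le_exp (mul_nonneg (sub_nonneg.2 hxy) (by positivity))
    _ = Real.exp (y * (2 * t)) * Real.exp (-(x * t)) ^ 2 := by
        rw [← Real.exp_nat_mul, ← Real.exp_add]
        congr 1; push_cast; ring
    _ ≤ Real.exp (y * (2 * t)) * (x ^ s * Real.exp (-(x * t))) ^ 2 := by
        gcongr
        exact le_mul_of_one_le_left (Real.exp_pos _).le (Real.one_le_rpow hx hs)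

lemma hasUpperRate_exp_rpow (hα : 0 < α) (hβ : 0 < β) (hs : 0 < s) (ht : 0 < t)
    (hB : DominatesOn B fun j => Real.exp (-(j * t))) (ha : DominatesOn {a} fun j => (j : ℝ) ^ s) :
    HasUpperRate a B α β fun ε σ =>
      max (Real.log (1 / ε) ^ (-(2 * s))) (Real.log (1 / σ) ^ (-(2 * s))) := by
  set G := √(Real.exp (4 * t) / (Real.exp (4 * t) - 1))
  have hG : 0 < G := sqrt_exp_div_pos ht
  refine hasUpperRate_of_truncation (C := (4 * t) ^ (2 * s) + (G + 1) * (2 * s) ^ (2 * s))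
    (Q := fun D => Real.exp (D * (2 * t))) hα hβ (fun j => by positivity) (fun j => by positivity)
    (fun i j hij => by gcongr; exact_mod_cast hij) hB ha (fun D => by positivity)
    (fun D => by positivity) (sum_exp_neg_pow_four_inv_le ht)
    (fun D j hj => one_le_exp_mul_rpow_mul_exp_sq hs.le ht.le (by exact_mod_cast one_le (a := j))
      (by exact_mod_cast hj)) (by positivity) ?_
  have hlarge := eventually_le_log_one_div (2 * t)
  filter_upwards [hlarge.prod_mk hlarge, prod_mem_prod self_mem_nhdsWithin self_mem_nhdsWithin]
    with ⟨ε, σ⟩ ⟨hlogε, hlogσ⟩ ⟨hε, hσ⟩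
  set δ := max ε σ with hδ_def
  have hδ : 0 < δ := lt_max_of_lt_left hε
  have hlog : 2 * t ≤ Real.log (1 / δ) := by
    rcases max_choice ε σ with h | h <;> rw [hδ_def, h] <;> assumption
  obtain ⟨D, hDl, -, hDu⟩ := exists_pnat_floor ((one_le_div (by positivity)).2 hlog)
  refine ⟨D, ?_⟩
  calc (((D : ℝ) ^ s) ^ 2)⁻¹ + ε ^ 2 * (G * Real.exp (D * (2 * t))) +
        σ ^ 2 * Real.exp (D * (2 * t))
      ≤ (((D : ℝ) ^ s) ^ 2)⁻¹ + δ ^ 2 * (G * Real.exp (D * (2 * t))) +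
          δ ^ 2 * Real.exp (D * (2 * t)) := by
        gcongr
        exacts [hε.le, le_max_left _ _, hσ.le, le_max_right _ _]
    _ = (((D : ℝ) ^ s) ^ 2)⁻¹ + δ ^ 2 * ((G + 1) * Real.exp (D * (2 * t))) := by ring
    _ ≤ _ := rpow_sq_inv_add_le_mul_log_rpow_neg hs ht (by positivity) hδ
        (hlog.trans_lt' (by positivity)) hDl hDu
    _ ≤ _ := by
        gcongr
        rcases max_choice ε σ with h | h <;> rw [hδ_def, h] <;> simp

end Rates

section LogFactors

variable {γ m p : ℝ}

lemma eventually_one_le_log_one_div_rpow (hγ : 0 ≤ γ) :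
    ∀ᶠ σ in 𝓝[>] (0 : ℝ), 1 ≤ Real.log (1 / σ) ^ γ := by
  filter_upwards [eventually_le_log_one_div 1] with σ hlog using Real.one_le_rpow hlog hγ

lemma eventually_rpow_le_mul_log_rpow_rpow (hγ : 0 ≤ γ) (hm : 0 ≤ m) :
    ∀ᶠ σ in 𝓝[>] (0 : ℝ), σ ^ m ≤ (σ * Real.log (1 / σ) ^ γ) ^ m := by
  filter_upwards [eventually_one_le_log_one_div_rpow hγ, self_mem_nhdsWithin] with σ hlog hσ
  exact Real.rpow_le_rpow hσ.le (le_mul_of_one_le_right hσ.le hlog) hm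

lemma eventually_log_rpow_neg_le (hγ : 0 ≤ γ) (hγ' : γ ≤ 1) (hp : 0 ≤ p) :
    ∀ᶠ σ in 𝓝[>] (0 : ℝ),
      Real.log (1 / σ) ^ (-p) ≤ Real.log (1 / (σ * Real.log (1 / σ) ^ γ)) ^ (-p) := by
  filter_upwards [eventually_le_log_one_div 1, self_mem_nhdsWithin] with σ hlog hσ
  set L := Real.log (1 / σ)
  have hL₀ : 0 < L := by positivity
  have hlogL : 0 ≤ Real.log L := Real.log_nonneg hlog
  have heq : Real.log (1 / (σ * L ^ γ)) = L - γ * Real.log L := by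
    rw [← div_div, Real.log_div (by simpa using hσ.ne') (by positivity), Real.log_rpow hL₀]
  rw [heq]
  refine Real.rpow_le_rpow_of_nonpos ?_ (sub_le_self _ (by positivity)) (neg_nonpos.2 hp)
  linarith [Real.log_le_sub_one_of_pos hL₀, mul_le_of_le_one_left hlogL hγ']

lemma eventually_sq_le_sq_mul_log_rpow (hγ : 0 ≤ γ) :
    ∀ᶠ σ in 𝓝[>] (0 : ℝ), σ ^ 2 ≤ σ ^ 2 * Real.log (1 / σ) ^ γ := by
  filter_upwards [eventually_one_le_log_one_div_rpow hγ] with σ hlog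
    using le_mul_of_one_le_right (sq_nonneg σ) hlog

end LogFactors

end GSM

end

theorem theorem3_general {α β s t : ℝ} (hα : 0 < α) (hβ : 0 < β) (hs : 0 < s) (ht : 0 < t)
    (a : ℕ+ → ℝ) (B : Set (ℕ+ → ℝ)) :
    (GSM.DominatesOn B (fun j => (j : ℝ) ^ (-t)) →
      GSM.DominatesOn {a} (fun j => (j : ℝ) ^ s) →
      GSM.HasUpperRate a B α β fun ε σ =>
        max (ε ^ (4 * s / (2 * s + 2 * t + 1 / 2))) (σ ^ (2 * min (s / t) 1))) ∧
    (GSM.DominatesOn B (fun j => (j : ℝ) ^ (-t)) →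
      GSM.DominatesOn {a} (fun j => Real.exp (j * s)) →
      GSM.HasUpperRate a B α β fun ε σ =>
        max (ε ^ 2 * Real.log (1 / ε) ^ (2 * t + 1 / 2)) (σ ^ 2)) ∧
    (GSM.DominatesOn B (fun j => Real.exp (-(j * t))) →
      GSM.DominatesOn {a} (fun j => (j : ℝ) ^ s) →
      GSM.HasUpperRate a B α β fun ε σ =>
        max (Real.log (1 / ε) ^ (-(2 * s))) (Real.log (1 / σ) ^ (-(2 * s)))) ∧
    (GSM.DominatesOn B (fun j => Real.exp (-(j * t))) →
      GSM.DominatesOn {a} (fun j => Real.exp (j * s)) →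
      GSM.HasUpperRate a B α β fun ε σ =>
        max (ε ^ (2 * s / (s + t))) (σ ^ (2 * min (s / t) 1))) :=
  ⟨GSM.hasUpperRate_rpow_rpow hα hβ hs ht, GSM.hasUpperRate_rpow_exp hα hβ hs ht,
    GSM.hasUpperRate_exp_rpow hα hβ hs ht, GSM.hasUpperRate_exp_exp hα hβ hs ht⟩

/-- The set `B` holds the possible values of the unknown sequence `b`. A singleton `B = {b}` gives
the error probabilities at one fixed `b`; a larger `B` asks for one test that serves all its
members. -/
theorem theorem3 (α β : ℝ) (hα : α ∈ Set.Ioo (0 : ℝ) 1) (hβ : β ∈ Set.Ioo (0 : ℝ) 1)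
    (s t : ℝ) (hs : 0 < s) (ht : 0 < t)
    (a : ℕ+ → ℝ) (ha : GSM.IsSmoothness a) (B : Set (ℕ+ → ℝ)) :
    (GSM.EquivOn B (fun j => (j : ℝ) ^ (-t)) → GSM.SeqEquiv a (fun j => (j : ℝ) ^ s) →
      GSM.HasUpperRate a B α β fun ε σ =>
        max (ε ^ (4 * s / (2 * s + 2 * t + 1 / 2)))
          ((σ * Real.log (1 / σ) ^ (3 / 4 : ℝ)) ^ (2 * min (s / t) 1))) ∧
    (GSM.EquivOn B (fun j => (j : ℝ) ^ (-t)) → GSM.SeqEquiv a (fun j => Real.exp (j * s)) →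
      GSM.HasUpperRate a B α β fun ε σ =>
        max (ε ^ 2 * Real.log (1 / ε) ^ (2 * t + 1 / 2))
          (σ ^ 2 * Real.log (1 / σ) ^ (3 / 2 : ℝ))) ∧
    (GSM.EquivOn B (fun j => Real.exp (-(j * t))) → GSM.SeqEquiv a (fun j => (j : ℝ) ^ s) →
      GSM.HasUpperRate a B α β fun ε σ =>
        max (Real.log (1 / ε) ^ (-(2 * s)))
          (Real.log (1 / (σ * Real.log (1 / σ) ^ (1 / 2 : ℝ))) ^ (-(2 * s)))) ∧
    (GSM.EquivOn B (fun j => Real.exp (-(j * t))) → GSM.SeqEquiv a (fun j => Real.exp (j * s)) →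
      GSM.HasUpperRate a B α β fun ε σ =>
        max (ε ^ (2 * s / (s + t)))
          ((σ * Real.log (1 / σ) ^ (1 / 2 : ℝ)) ^ (2 * min (s / t) 1))) := by
  have hpow (r : ℝ) (j : ℕ+) : 0 < (j : ℝ) ^ r := by positivity
  have hexp (u : ℕ+ → ℝ) (j : ℕ+) : 0 < Real.exp (u j) := Real.exp_pos _
  obtain ⟨h_pow_pow, h_pow_exp, h_exp_pow, h_exp_exp⟩ := theorem3_general hα.1 hβ.1 hs ht a B
  exact
    ⟨fun hB ha' => (h_pow_pow (hB.dominatesOn (hpow _))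
        (ha'.dominatesOn_singleton (hpow _))).mono_max_right
        (GSM.eventually_rpow_le_mul_log_rpow_rpow (by norm_num) (by positivity)),
      fun hB ha' => (h_pow_exp (hB.dominatesOn (hpow _))
        (ha'.dominatesOn_singleton (hexp _))).mono_max_right
        (GSM.eventually_sq_le_sq_mul_log_rpow (by norm_num)),
      fun hB ha' => (h_exp_pow (hB.dominatesOn (hexp _))
        (ha'.dominatesOn_singleton (hpow _))).mono_max_right
        (GSM.eventually_log_rpow_neg_le (by norm_num) (by norm_num) (by positivity)),
      fun hB ha' => (h_exp_exp (hB.dominatesOn (hexp _))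
        (ha'.dominatesOn_singleton (hexp _))).mono_max_right
        (GSM.eventually_rpow_le_mul_log_rpow_rpow (by norm_num) (by positivity))⟩
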